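/- Let $Q\to\mathbb R$ be a smooth fibre bundle over the time axis with an $m$-dimensional typical fibre and bundle coordinates $(t,q^i)$. Let $J^1Q$ be its first order jet manifold, with coordinates $(t,q^i,q^i_t)$, and let $\pi_Q:V^*Q\to Q$ be its vertical cotangent bundle, with coordinates $(t,q^i,p_i)$. Let $L=\mathcal L\,dt$ be a Lagrangian with a smooth $\mathcal L:J^1Q\to\mathbb R$. Put $\pi_i=\partial\mathcal L/\partial q^i_t$, let $\widehat L:J^1Q\to V^*Q$ be the Legendre map over $Q$, $p_i\circ\widehat L=\pi_i$, and let $N_L=\widehat L(J^1Q)$ be the Lagrangian constraint space. Assume that $L$ is almost regular: (i) $N_L$ is a closed imbedded subbundle of $V^*Q\to Q$; (ii) $\widehat L:J^1Q\to N_L$ is a surjective submersion; (iii) for every $z\in N_L$ the pre-image $\widehat L^{-1}(z)$ is a connected submanifold of $J^1Q$. Let $H=h^*\Xi=p_i\,dq^i-\mathcal H\,dt$ be a Hamiltonian form on $V^*Q$, that is, the pull-back of the Liouville form $\Xi$ of $T^*Q$ by a smooth global section $h$ of the canonical fibration $T^*Q\to V^*Q$ (the Hamiltonian $\mathcal H$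 depends on the bundle coordinates). Let $\widehat H:V^*Q\to J^1Q$ be the Hamiltonian map over $Q$, $q^i_t\circ\widehat H=\partial\mathcal H/\partial p_i$, and put $H_{\widehat H}=p_i\,dq^i-p_i\frac{\partial\mathcal H}{\partial p_i}\,dt$. Assume that $H$ is weakly associated with $L$, that is, $\widehat L\circ\widehat H\circ\widehat L=\widehat L$ on $J^1Q$, and $H=H_{\widehat H}+(\mathcal L\circ\widehat H)\,dt$ at all points of $N_L$. Let $U\subseteq\mathbb R$ be open (for instance $U=\mathbb R$) and let $r:U\to V^*Q$ be a smooth section of $V^*Q\to\mathbb R$ over $U$ that solves the Hamilton equations $$\frac{dq^i}{dt}=\frac{\partial\mathcal H}{\partial p_i},\qquad \frac{dp_i}{dt}=-\frac{\partial\mathcal H}{\partial q^i}$$ and lives in $N_L$, i.e. $r(t)\in N_L$ for all $t\in U$. Then $c=\pi_Q\circ r$ is a smooth section of $Q\to\mathbb R$ over $U$ that satisfies the Lagrange equations $$\frac{\partial\mathcal L}{\partial q^i}-d_t\pi_i=0,\qquad d_t=\partial_t+q^j_t\frac{\partial}{\partial q^j}+q^j_{tt}\frac{\partial}{\partial q^j_t},$$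 and $\overline c=\widehat H\circ r$ is a smooth section of $J^1Q\to\mathbb R$ over $U$ that satisfies the Cartan equations $$\frac{\partial\pi_j}{\partial q^i_t}\,(\widehat q^j_t-q^j_t)=0,\qquad \frac{\partial\mathcal L}{\partial q^i}-\widehat d_t\pi_i+(\widehat q^j_t-q^j_t)\frac{\partial\pi_j}{\partial q^i}=0,\qquad \widehat d_t=\partial_t+\widehat q^j_t\frac{\partial}{\partial q^j}+q^j_{tt}\frac{\partial}{\partial q^j_t},$$ where along a section $(t,q^i(t),q^i_t(t))$ of $J^1Q\to\mathbb R$ one puts $\widehat q^i_t=dq^i/dt$ and $q^i_{tt}=dq^i_t/dt$. -/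

import Mathlib

open Set Bundle Manifold
open scoped ContDiff Topology

noncomputable section

namespace TimeMech

/-- The coordinate space `ℝ^m` of the positions `q^i` and of the velocities `q^i_t`. -/
abbrev Vel (m : ℕ) : Type := EuclideanSpace ℝ (Fin m)

/-- The space of the momenta `p_i`. -/
abbrev Mom (m : ℕ) : Type := Vel m →L[ℝ] ℝ

/-- The model of a configuration space: the coordinates are `(t, q^i)`. -/
abbrev QModel (m : ℕ) : ModelWithCorners ℝ (ℝ × Vel m) (ℝ × Vel m) := 𝓘(ℝ, ℝ × Vel m)

/-- The `i`-th coordinate vector of `ℝ^m`. -/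
abbrev basisVec {m : ℕ} (i : Fin m) : Vel m := EuclideanSpace.single i 1

/-- The `i`-th coordinate covector of `ℝ^m`. -/
abbrev basisCovec {m : ℕ} (i : Fin m) : Mom m := EuclideanSpace.proj i

/-- A manifold `Q` fibred over the time axis, with projection `time : Q → ℝ`, whose smooth structure
is given by an atlas of bundle coordinates `(t, q^i)`, that is, the first coordinate of each chart
is the projection onto the time axis. -/
class FibredOverTime (m : ℕ) (Q : Type*) [TopologicalSpace Q] [ChartedSpace (ℝ × Vel m) Q] where
  time : Q → ℝ
  chart_time : ∀ i ∈ atlas (ℝ × Vel m) Q, ∀ x ∈ i.source, (i x).1 = time x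

/-- `proj : X → B` is a smooth locally trivial fibre bundle with typical fibre `F`. -/
def IsSmoothFibreBundle (EB EX EF : Type*)
    [NormedAddCommGroup EB] [NormedSpace ℝ EB] [NormedAddCommGroup EX] [NormedSpace ℝ EX]
    [NormedAddCommGroup EF] [NormedSpace ℝ EF]
    {B X : Type*} [TopologicalSpace B] [ChartedSpace EB B] [TopologicalSpace X] [ChartedSpace EX X]
    (F : Type*) [TopologicalSpace F] [ChartedSpace EF F] (proj : X → B) : Prop :=
  ∀ b : B, ∃ e : Trivialization F proj, b ∈ e.baseSet ∧
    ContMDiffOn 𝓘(ℝ, EX) (𝓘(ℝ, EB).prod 𝓘(ℝ, EF)) ∞ e e.source ∧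
    ContMDiffOn (𝓘(ℝ, EB).prod 𝓘(ℝ, EF)) 𝓘(ℝ, EX) ∞ e.toOpenPartialHomeomorph.symm e.target

variable (m : ℕ) (Q : Type*) [TopologicalSpace Q] [ChartedSpace (ℝ × Vel m) Q]
  [IsManifold (QModel m) ∞ Q]

/-- The Jacobian at `x` of the transition from the bundle coordinates `i` to the bundle
coordinates `j`. -/
abbrev jac (i j : atlas (ℝ × Vel m) Q) (x : Q) : (ℝ × Vel m) →L[ℝ] (ℝ × Vel m) :=
  (tangentBundleCore (QModel m) Q).coordChange i j x

/-- The vertical part `∂q'^i/∂q^j` of the Jacobian. -/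
def vertJac (i j : atlas (ℝ × Vel m) Q) (x : Q) : Vel m →L[ℝ] Vel m :=
  (ContinuousLinearMap.snd ℝ ℝ (Vel m)).comp
    ((jac m Q i j x).comp (ContinuousLinearMap.inr ℝ ℝ (Vel m)))

variable {m Q}

theorem vertJac_apply (i j : atlas (ℝ × Vel m) Q) (x : Q) (v : Vel m) :
    vertJac m Q i j x v = (jac m Q i j x (0, v)).2 := rfl

theorem contMDiffOn_jac (i j : atlas (ℝ × Vel m) Q) :
    ContMDiffOn (QModel m) 𝓘(ℝ, (ℝ × Vel m) →L[ℝ] (ℝ × Vel m)) ∞ (jac m Q i j)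
      (i.1.source ∩ j.1.source) := by
  have h : IsManifold (QModel m) (∞ + 1) Q := ‹IsManifold (QModel m) ∞ Q›
  have := tangentBundleCore.isContMDiff (I := QModel m) (M := Q) (n := ∞)
  exact (tangentBundleCore (QModel m) Q).contMDiffOn_coordChange (QModel m) i j

/-- Transitions between bundle coordinates preserve the time component of tangent vectors. -/
theorem jac_fst [FibredOverTime m Q] (i j : atlas (ℝ × Vel m) Q) {x : Q}
    (hi : x ∈ i.1.source) (hj : x ∈ j.1.source) (w : ℝ × Vel m) : (jac m Q i j x w).1 = w.1 := by
  have hd : HasFDerivAt (j.1 ∘ i.1.symm) (jac m Q i j x) (i.1 x) := by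
    have h1 : DifferentiableAt ℝ (j.1 ∘ i.1.symm) (i.1 x) := by
      have := (QModel m).contDiffWithinAt_extendCoordChange'
        (IsManifold.subset_maximalAtlas (n := ∞) i.2) (IsManifold.subset_maximalAtlas j.2) hi hj
      have h2 := this.differentiableWithinAt (by simp)
      rw [← differentiableWithinAt_univ]
      simpa [ModelWithCorners.extendCoordChange] using h2
    have h3 : jac m Q i j x = fderiv ℝ (j.1 ∘ i.1.symm) (i.1 x) := by
      simp [jac, tangentBundleCore_coordChange, OpenPartialHomeomorph.extend]
    rw [h3]
    exact h1.hasFDerivAt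
  have h4 : HasFDerivAt (fun y => ((j.1 ∘ i.1.symm) y).1)
      ((ContinuousLinearMap.fst ℝ ℝ (Vel m)).comp (jac m Q i j x)) (i.1 x) := hd.fst
  have h5 : (fun y => ((j.1 ∘ i.1.symm) y).1) =ᶠ[𝓝 (i.1 x)] fun y => y.1 := by
    have hs : ∀ᶠ y in 𝓝 (i.1 x), y ∈ i.1.target := i.1.open_target.mem_nhds (i.1.map_source hi)
    have hs' : ∀ᶠ y in 𝓝 (i.1 x), i.1.symm y ∈ j.1.source := by
      refine (i.1.continuousAt_symm (i.1.map_source hi)).eventually ?_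
      rw [i.1.left_inv hi]
      exact j.1.open_source.mem_nhds hj
    filter_upwards [hs, hs'] with y hy hy'
    rw [Function.comp_apply, FibredOverTime.chart_time j.1 j.2 _ hy',
      ← FibredOverTime.chart_time i.1 i.2 _ (i.1.map_target hy), i.1.right_inv hy]
  have h6 := (h4.congr_of_eventuallyEq h5.symm).unique hasFDerivAt_fst
  exact DFunLike.congr_fun h6 w

theorem jac_comp (i j k : atlas (ℝ × Vel m) Q) {x : Q}
    (hx : x ∈ i.1.source ∩ j.1.source ∩ k.1.source) (w : ℝ × Vel m) :
    jac m Q j k x (jac m Q i j x w) = jac m Q i k x w :=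
  (tangentBundleCore (QModel m) Q).coordChange_comp i j k x hx w

theorem jac_self (i : atlas (ℝ × Vel m) Q) {x : Q} (hx : x ∈ i.1.source) (w : ℝ × Vel m) :
    jac m Q i i x w = w :=
  (tangentBundleCore (QModel m) Q).coordChange_self i x hx w

theorem vertJac_comp [FibredOverTime m Q] (i j k : atlas (ℝ × Vel m) Q) {x : Q}
    (hx : x ∈ i.1.source ∩ j.1.source ∩ k.1.source) (v : Vel m) :
    vertJac m Q j k x (vertJac m Q i j x v) = vertJac m Q i k x v := by
  have h : ((0 : ℝ), (jac m Q i j x (0, v)).2) = jac m Q i j x (0, v) :=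
    Prod.ext (jac_fst i j hx.1.1 hx.1.2 (0, v)).symm rfl
  simp only [vertJac_apply]
  rw [h, jac_comp i j k hx]

variable (m Q)

/-- The cocycle of the vertical cotangent bundle `V^*Q → Q`: the momenta transform as
`p'_j = (∂q^i/∂q'^j) p_i`. -/
def legendreCore [FibredOverTime m Q] :
    VectorBundleCore ℝ Q (Mom m) (atlas (ℝ × Vel m) Q) where
  baseSet i := i.1.source
  isOpen_baseSet i := i.1.open_source
  indexAt := achart (ℝ × Vel m)
  mem_baseSet_at := mem_chart_source (ℝ × Vel m)
  coordChange i j x := (ContinuousLinearMap.compL ℝ (Vel m) (Vel m) ℝ).flip (vertJac m Q j i x)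
  coordChange_self i x hx p := by
    ext v
    simp only [ContinuousLinearMap.flip_apply, ContinuousLinearMap.compL_apply,
      ContinuousLinearMap.comp_apply]
    rw [vertJac_apply, jac_self i hx]
  continuousOn_coordChange i j := by
    have h := (contMDiffOn_jac j i).continuousOn
    rw [inter_comm] at h
    exact (ContinuousLinearMap.continuous _).comp_continuousOn
      (continuousOn_const.clm_comp (h.clm_comp continuousOn_const))
  coordChange_comp i j k x hx p := by
    ext v
    simp only [ContinuousLinearMap.flip_apply, ContinuousLinearMap.compL_apply,
      ContinuousLinearMap.comp_apply]
    rw [vertJac_comp k j i ⟨⟨hx.2, hx.1.2⟩, hx.1.1⟩]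

instance [FibredOverTime m Q] : (legendreCore m Q).IsContMDiff (QModel m) ∞ where
  contMDiffOn_coordChange i j := by
    have h := contMDiffOn_jac j i
    rw [inter_comm] at h
    have h2 : ContMDiffOn (QModel m) 𝓘(ℝ, Vel m →L[ℝ] Vel m) ∞ (vertJac m Q j i)
        (i.1.source ∩ j.1.source) :=
      contMDiffOn_const.clm_comp (h.clm_comp contMDiffOn_const)
    exact (ContinuousLinearMap.contMDiff _).comp_contMDiffOn h2

/-- The Legendre bundle `V^*Q`, the vertical cotangent bundle of `Q → ℝ`. A point over `q` is
`⟨q, p⟩`, where `p` are the momenta relative to the preferred chart at `q`. -/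
abbrev LegendreBundle [FibredOverTime m Q] : Type _ :=
  TotalSpace (Mom m) (legendreCore m Q).Fiber

/-- The momentum of a point of `V^*Q` over `q`, relative to the preferred chart at `q`. -/
def LegendreBundle.mom {m : ℕ} {Q : Type*} [TopologicalSpace Q] [ChartedSpace (ℝ × Vel m) Q]
    [IsManifold (QModel m) ∞ Q] [FibredOverTime m Q] (z : LegendreBundle m Q) : Mom m := z.snd

/-- The model of `V^*Q`, with coordinates `((t, q^i), p_i)`. -/
abbrev LModel : ModelWithCorners ℝ ((ℝ × Vel m) × Mom m) (ModelProd (ℝ × Vel m) (Mom m)) :=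
  (QModel m).prod 𝓘(ℝ, Mom m)

/-- The cocycle of the affine jet bundle `J^1Q → Q`: the velocities transform as
`q'^i_t = ∂_t q'^i + q^j_t ∂_j q'^i`. -/
def jetCore [FibredOverTime m Q] :
    FiberBundleCore (atlas (ℝ × Vel m) Q) Q (Vel m) where
  baseSet i := i.1.source
  isOpen_baseSet i := i.1.open_source
  indexAt := achart (ℝ × Vel m)
  mem_baseSet_at := mem_chart_source (ℝ × Vel m)
  coordChange i j x v := (jac m Q i j x (1, v)).2
  coordChange_self i x hx v := by rw [jac_self i hx]
  continuousOn_coordChange i j := by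
    have h := (contMDiffOn_jac i j).continuousOn
    have h2 : ContinuousOn (fun p : Q × Vel m => jac m Q i j p.1)
        ((i.1.source ∩ j.1.source) ×ˢ univ) :=
      h.comp continuousOn_fst fun p hp => hp.1
    exact (h2.clm_apply (continuousOn_const.prodMk continuousOn_snd)).snd
  coordChange_comp i j k x hx v := by
    have h : ((1 : ℝ), (jac m Q i j x (1, v)).2) = jac m Q i j x (1, v) :=
      Prod.ext (jac_fst i j hx.1.1 hx.1.2 (1, v)).symm rfl
    rw [h, jac_comp i j k hx]

/-- The first order jet manifold `J^1Q` of `Q → ℝ`. A point over `q` is `⟨q, v⟩`, where `v` is the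
velocity `q^i_t` relative to the preferred chart at `q`. -/
abbrev JetBundle [FibredOverTime m Q] : Type _ :=
  TotalSpace (Vel m) (jetCore m Q).Fiber

/-- The velocity `q^i_t` of a point of `J^1Q` over `q`, relative to the preferred chart at `q`. -/
def JetBundle.vel {m : ℕ} {Q : Type*} [TopologicalSpace Q] [ChartedSpace (ℝ × Vel m) Q]
    [IsManifold (QModel m) ∞ Q] [FibredOverTime m Q] (x : JetBundle m Q) : Vel m := x.snd

/-- The model of `J^1Q`, with coordinates `((t, q^i), q^i_t)`. -/
abbrev JModel : ModelWithCorners ℝ ((ℝ × Vel m) × Vel m) (ModelProd (ℝ × Vel m) (Vel m)) :=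
  (QModel m).prod 𝓘(ℝ, Vel m)

/-- The cotangent bundle `T^*Q`. -/
abbrev CotangentBundle : Type _ :=
  TotalSpace ((ℝ × Vel m) →L[ℝ] ℝ) (fun q : Q => TangentSpace (QModel m) q →L[ℝ] Trivial Q ℝ q)

/-- The model of `T^*Q`. -/
abbrev CModel : ModelWithCorners ℝ ((ℝ × Vel m) × ((ℝ × Vel m) →L[ℝ] ℝ))
    (ModelProd (ℝ × Vel m) ((ℝ × Vel m) →L[ℝ] ℝ)) :=
  (QModel m).prod 𝓘(ℝ, (ℝ × Vel m) →L[ℝ] ℝ)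

variable {m Q} [FibredOverTime m Q]

instance : IsManifold (JModel m) ∞ (JetBundle m Q) := by
  refine isManifold_of_contDiffOn _ _ _ ?_
  rintro _ _ ⟨_, ⟨_, ⟨i, rfl⟩, rfl⟩, _, ⟨a, ha, _, rfl, rfl⟩, rfl⟩
    ⟨_, ⟨_, ⟨j, rfl⟩, rfl⟩, _, ⟨b, hb, _, rfl, rfl⟩, rfl⟩
  have key : ContDiffOn ℝ ∞ (fun w : (ℝ × Vel m) × Vel m =>
      (b (a.symm w.1), (jac m Q i j (a.symm w.1) (1, w.2)).2))
      {w | w.1 ∈ a.target ∧ a.symm w.1 ∈ b.source ∧ a.symm w.1 ∈ i.1.source ∩ j.1.source} := by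
    have h1 : ContMDiffOn (QModel m) (QModel m) ∞ a.symm a.target :=
      contMDiffOn_symm_of_mem_maximalAtlas (IsManifold.subset_maximalAtlas ha)
    have h2 : ContMDiffOn (QModel m) (QModel m) ∞ b b.source :=
      contMDiffOn_of_mem_maximalAtlas (IsManifold.subset_maximalAtlas hb)
    have h3 := (h2.comp (h1.mono inter_subset_left)
      (fun y hy => hy.2 : a.target ∩ a.symm ⁻¹' b.source ⊆ a.symm ⁻¹' b.source)).contDiffOn
    have h4 := ((contMDiffOn_jac i j).comp (h1.mono inter_subset_left)
      (fun y hy => hy.2 : a.target ∩ a.symm ⁻¹' (i.1.source ∩ j.1.source) ⊆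
        a.symm ⁻¹' (i.1.source ∩ j.1.source))).contDiffOn
    have h5 := h3.comp (t := a.target ∩ a.symm ⁻¹' b.source)
      (s := {w : (ℝ × Vel m) × Vel m | w.1 ∈ a.target ∧ a.symm w.1 ∈ b.source ∧
        a.symm w.1 ∈ i.1.source ∩ j.1.source}) contDiff_fst.contDiffOn
      fun w hw => ⟨hw.1, hw.2.1⟩
    have h6 := h4.comp (t := a.target ∩ a.symm ⁻¹' (i.1.source ∩ j.1.source))
      (s := {w : (ℝ × Vel m) × Vel m | w.1 ∈ a.target ∧ a.symm w.1 ∈ b.source ∧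
        a.symm w.1 ∈ i.1.source ∩ j.1.source}) contDiff_fst.contDiffOn
      fun w hw => ⟨hw.1, hw.2.2⟩
    exact h5.prodMk (h6.clm_apply (contDiff_const.prodMk contDiff_snd).contDiffOn).snd
  have hsub : ∀ w : (ℝ × Vel m) × Vel m, w ∈ (JModel m).symm ⁻¹'
      ((((jetCore m Q).localTriv i).toOpenPartialHomeomorph ≫ₕ
        a.prod (OpenPartialHomeomorph.refl (Vel m))).symm ≫ₕ
      (((jetCore m Q).localTriv j).toOpenPartialHomeomorph ≫ₕ
        b.prod (OpenPartialHomeomorph.refl (Vel m)))).source ∩ range (JModel m) →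
      w.1 ∈ a.target ∧ a.symm w.1 ∈ b.source ∧ a.symm w.1 ∈ i.1.source ∩ j.1.source := by
    rintro ⟨y, v⟩ ⟨hw, -⟩
    simp only [mfld_simps] at hw
    exact ⟨hw.1.1.1, hw.2.2, hw.1.2, hw.2.1⟩
  refine (key.congr ?_).mono hsub
  rintro ⟨y, v⟩ ⟨h1, h2, h3⟩
  exact Prod.ext rfl ((jetCore m Q).coordChange_comp i (achart (ℝ × Vel m) (a.symm y)) j (a.symm y)
    ⟨⟨h3.1, mem_chart_source _ _⟩, h3.2⟩ v)

/-- The projection of `Q` onto the time axis. -/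
abbrev time (m : ℕ) {Q : Type*} [TopologicalSpace Q] [ChartedSpace (ℝ × Vel m) Q]
    [FibredOverTime m Q] : Q → ℝ := FibredOverTime.time m

/-- The coordinates `((t, q^i), q^i_t)` of a point of `J^1Q` in the bundle chart `i`. -/
def jetCoord (i : atlas (ℝ × Vel m) Q) (x : JetBundle m Q) : (ℝ × Vel m) × Vel m :=
  (i.1 x.proj, ((jetCore m Q).localTriv i x).2)

/-- The point of `J^1Q` with given coordinates in the bundle chart `i`. -/
def jetPoint (i : atlas (ℝ × Vel m) Q) (w : (ℝ × Vel m) × Vel m) : JetBundle m Q :=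
  ((jetCore m Q).localTriv i).toOpenPartialHomeomorph.symm (i.1.symm w.1, w.2)

/-- The coordinates `((t, q^i), p_i)` of a point of `V^*Q` in the bundle chart `i`. -/
def legCoord (i : atlas (ℝ × Vel m) Q) (z : LegendreBundle m Q) : (ℝ × Vel m) × Mom m :=
  (i.1 z.proj, ((legendreCore m Q).localTriv i z).2)

/-- The point of `V^*Q` with given coordinates in the bundle chart `i`. -/
def legPoint (i : atlas (ℝ × Vel m) Q) (w : (ℝ × Vel m) × Mom m) : LegendreBundle m Q :=
  ((legendreCore m Q).localTriv i).toOpenPartialHomeomorph.symm (i.1.symm w.1, w.2)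

/-! ### Lagrangians -/

/-- The coordinate expression of a Lagrangian `L = ℒ dt` in the bundle chart `i`. -/
def lagrangianIn (ℒ : JetBundle m Q → ℝ) (i : atlas (ℝ × Vel m) Q) :
    (ℝ × Vel m) × Vel m → ℝ := fun w => ℒ (jetPoint i w)

/-- The Legendre map `L̂ : J^1Q → V^*Q`, `p_i ∘ L̂ = ∂ℒ/∂q^i_t`, the fibre derivative of `ℒ`. -/
def legendreMap (ℒ : JetBundle m Q → ℝ) (x : JetBundle m Q) : LegendreBundle m Q :=
  ⟨x.proj, fderiv ℝ (fun v : Vel m => ℒ ⟨x.proj, v⟩) (JetBundle.vel x)⟩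

/-- The Lagrangian constraint space `N_L = L̂(J^1Q)`. -/
def constraintSpace (ℒ : JetBundle m Q → ℝ) : Set (LegendreBundle m Q) := range (legendreMap ℒ)

/-- A Lagrangian is almost regular if (i) `N_L` is a closed imbedded subbundle of `V^*Q → Q`,
(ii) the Legendre map `J^1Q → N_L` is a fibred manifold, i.e. a surjective submersion, and
(iii) the pre-image of each point of `N_L` is connected (by (ii) it is a submanifold). -/
def IsAlmostRegular (ℒ : JetBundle m Q → ℝ) : Prop :=
  IsClosed (constraintSpace ℒ) ∧
  (∃ (k : ℕ) (_ : ChartedSpace (EuclideanSpace ℝ (Fin k)) (constraintSpace ℒ))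
      (_ : IsManifold 𝓘(ℝ, EuclideanSpace ℝ (Fin k)) ∞ (constraintSpace ℒ)),
    IsSmoothEmbedding 𝓘(ℝ, EuclideanSpace ℝ (Fin k)) (LModel m) ∞
      (Subtype.val : constraintSpace ℒ → LegendreBundle m Q) ∧
    (∃ (l : ℕ) (F : Type) (_ : TopologicalSpace F)
        (_ : ChartedSpace (EuclideanSpace ℝ (Fin l)) F)
        (_ : IsManifold 𝓘(ℝ, EuclideanSpace ℝ (Fin l)) ∞ F),
      IsSmoothFibreBundle (ℝ × Vel m) (EuclideanSpace ℝ (Fin k)) (EuclideanSpace ℝ (Fin l)) F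
        (fun z : constraintSpace ℒ => z.1.proj)) ∧
    IsSubmersion (JModel m) 𝓘(ℝ, EuclideanSpace ℝ (Fin k)) ∞
      (codRestrict (legendreMap ℒ) (constraintSpace ℒ) mem_range_self)) ∧
  ∀ z ∈ constraintSpace ℒ, IsConnected (legendreMap ℒ ⁻¹' {z})

/-- The momentum `π_j = ∂ℒ/∂q^j_t` in the bundle chart `i`. -/
def momentum (ℒ : JetBundle m Q → ℝ) (i : atlas (ℝ × Vel m) Q) (j : Fin m)
    (w : (ℝ × Vel m) × Vel m) : ℝ :=
  fderiv ℝ (lagrangianIn ℒ i) w (0, basisVec j)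

/-- The partial derivative `∂_j = ∂/∂q^j` of a function of `(t, q^i, q^i_t)`. -/
def dPos (j : Fin m) (f : (ℝ × Vel m) × Vel m → ℝ) (w : (ℝ × Vel m) × Vel m) : ℝ :=
  fderiv ℝ f w ((0, basisVec j), 0)

/-- The partial derivative `∂^t_j = ∂/∂q^j_t` of a function of `(t, q^i, q^i_t)`. -/
def dVel (j : Fin m) (f : (ℝ × Vel m) × Vel m → ℝ) (w : (ℝ × Vel m) × Vel m) : ℝ :=
  fderiv ℝ f w (0, basisVec j)

/-- The total derivative `∂_t + u^i ∂_i + a^i ∂^t_i` of a function of `(t, q^i, q^i_t)`. -/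
def dTotal (u a : Vel m) (f : (ℝ × Vel m) × Vel m → ℝ) (w : (ℝ × Vel m) × Vel m) : ℝ :=
  fderiv ℝ f w ((1, u), a)

/-- A smooth section, over `U ⊆ ℝ`, of a bundle `X → ℝ` with projection `τ`. -/
def IsSectionOn {EX HX X : Type*} [NormedAddCommGroup EX] [NormedSpace ℝ EX] [TopologicalSpace HX]
    (I : ModelWithCorners ℝ EX HX) [TopologicalSpace X] [ChartedSpace HX X]
    (τ : X → ℝ) (s : ℝ → X) (U : Set ℝ) : Prop :=
  ContMDiffOn 𝓘(ℝ, ℝ) I ∞ s U ∧ ∀ t ∈ U, τ (s t) = t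

/-- The section `c` of `Q → ℝ` over `U` satisfies the Lagrange equations
`(∂_j - d_t ∂^t_j) ℒ = 0`, i.e. `∂_j ℒ - d_t π_j = 0` with `d_t = ∂_t + q^i_t ∂_i + q^i_tt ∂^t_i`
at the second jet of `c`. -/
def IsLagrangeSolution (ℒ : JetBundle m Q → ℝ) (U : Set ℝ) (c : ℝ → Q) : Prop :=
  IsSectionOn (QModel m) (time m) c U ∧
  ∀ i : atlas (ℝ × Vel m) Q, ∀ t ∈ U, c t ∈ i.1.source → ∀ j : Fin m,
    let q : ℝ → Vel m := fun s => (i.1 (c s)).2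
    let w : (ℝ × Vel m) × Vel m := ((t, q t), deriv q t)
    dPos j (lagrangianIn ℒ i) w - dTotal (deriv q t) (deriv (deriv q) t) (momentum ℒ i j) w = 0

/-- The section `c` of `J^1Q → ℝ` over `U` satisfies the Cartan equations
`∂^t_j π_k (q̂^k_t - q^k_t) = 0`, `∂_j ℒ - d̂_t π_j + (q̂^k_t - q^k_t) ∂_j π_k = 0`, where
`d̂_t = ∂_t + q̂^i_t ∂_i + q^i_tt ∂^t_i` at the jet `(t, q^i, q^i_t, q̂^i_t, q^i_tt)` of `c`. -/
def IsCartanSolution (ℒ : JetBundle m Q → ℝ) (U : Set ℝ) (c : ℝ → JetBundle m Q) : Prop :=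
  IsSectionOn (JModel m) (fun x : JetBundle m Q => time m x.proj) c U ∧
  ∀ i : atlas (ℝ × Vel m) Q, ∀ t ∈ U, (c t).proj ∈ i.1.source → ∀ j : Fin m,
    let w : (ℝ × Vel m) × Vel m := jetCoord i (c t)
    let v : Vel m := w.2
    let u : Vel m := deriv (fun s => (jetCoord i (c s)).1.2) t
    let a : Vel m := deriv (fun s => (jetCoord i (c s)).2) t
    (∑ k : Fin m, dVel j (momentum ℒ i k) w * (u k - v k) = 0) ∧
    dPos j (lagrangianIn ℒ i) w - dTotal u a (momentum ℒ i j) w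
      + ∑ k : Fin m, (u k - v k) * dPos j (momentum ℒ i k) w = 0

/-! ### Hamiltonian forms -/

/-- The Liouville form `Ξ` on `T^*Q`: at `α` it is `α` composed with the tangent of `T^*Q → Q`. -/
def liouville (α : CotangentBundle m Q) : TangentSpace (CModel m) α →L[ℝ] ℝ :=
  ContinuousLinearMap.comp (α.snd : TangentSpace (QModel m) α.proj →L[ℝ] ℝ)
    (mfderiv (CModel m) (QModel m) (fun β : CotangentBundle m Q => β.proj) α)

/-- The fibration `ζ : T^*Q → V^*Q`, restriction of covectors to vertical tangent vectors. -/
def zeta (α : CotangentBundle m Q) : LegendreBundle m Q :=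
  ⟨α.proj, ContinuousLinearMap.comp (α.snd : (ℝ × Vel m) →L[ℝ] ℝ)
    (ContinuousLinearMap.inr ℝ ℝ (Vel m))⟩

variable (m Q) in
/-- A smooth section `h` of `ζ : T^*Q → V^*Q`, written as the family of the covectors
`h(z) ∈ T^*_{π_Q(z)}Q`. It stands for the Hamiltonian form `h^*Ξ`. -/
structure HamiltonianForm where
  cov : ∀ z : LegendreBundle m Q, TangentSpace (QModel m) z.proj →L[ℝ] ℝ
  smooth : ContMDiff (LModel m) (CModel m) ∞
    (fun z => (⟨z.proj, cov z⟩ : CotangentBundle m Q))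
  zeta_cov : ∀ z, zeta (⟨z.proj, cov z⟩ : CotangentBundle m Q) = z

namespace HamiltonianForm

variable (H : HamiltonianForm m Q)

/-- The section `h` as a map `V^*Q → T^*Q`. -/
def sec (z : LegendreBundle m Q) : CotangentBundle m Q := ⟨z.proj, H.cov z⟩

/-- The Hamiltonian form `H = h^*Ξ` on `V^*Q`. -/
def form (z : LegendreBundle m Q) : TangentSpace (LModel m) z →L[ℝ] ℝ :=
  (liouville (H.sec z)).comp (mfderiv (LModel m) (CModel m) H.sec z)

/-- The Hamiltonian `ℋ` in the bundle chart `i`, as a function of `((t, q^i), p_i)`. Since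
`H = h^*Ξ = p_i dq^i - ℋ dt`, it is minus the value of `h` on the coordinate vector field `∂_t`. -/
def hamiltonianIn (i : atlas (ℝ × Vel m) Q) (w : (ℝ × Vel m) × Mom m) : ℝ :=
  - H.cov (legPoint i w)
      (mfderiv 𝓘(ℝ, ℝ × Vel m) (QModel m) i.1.symm w.1 ((1, 0) : ℝ × Vel m))

/-- The Hamiltonian map `Ĥ : V^*Q → J^1Q`, `q^i_t ∘ Ĥ = ∂^i ℋ = ∂ℋ/∂p_i`. At a point over `q` it is
computed in the preferred chart at `q`, in which `∂_t` is the vector `(1, 0)`. -/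
def hamiltonianMap (z : LegendreBundle m Q) : JetBundle m Q :=
  ⟨z.proj, WithLp.toLp 2 fun j : Fin m =>
    fderiv ℝ (fun p : Mom m => - H.cov ⟨z.proj, p⟩ ((1, 0) : ℝ × Vel m))
      (LegendreBundle.mom z) (basisCovec j)⟩

end HamiltonianForm

/-- The tangent of the projection `π_Q : V^*Q → Q`. -/
def projTangent (z : LegendreBundle m Q) :
    TangentSpace (LModel m) z →L[ℝ] TangentSpace (QModel m) z.proj :=
  mfderiv (LModel m) (QModel m) (fun y : LegendreBundle m Q => y.proj) z

/-- The form `dt` on `V^*Q`; in bundle coordinates, the first component of tangent vectors of `Q`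
is `dt`. -/
def dtForm (z : LegendreBundle m Q) : TangentSpace (LModel m) z →L[ℝ] ℝ :=
  (ContinuousLinearMap.fst ℝ ℝ (Vel m)).comp
    (projTangent z : TangentSpace (LModel m) z →L[ℝ] ℝ × Vel m)

/-- The Hamiltonian form `H_Φ = -Φ ⌋ Θ = p_i dq^i - p_i Φ^i dt` of a bundle morphism
`Φ : V^*Q → J^1Q` over `Q`, where `Θ = p_i dq^i ∧ dt` and `Φ` is read as the tangent-valued
`∂_t + Φ^i ∂_i`. Over `q`, the components are those in the preferred chart at `q`. -/
def formOfMap (Φ : LegendreBundle m Q → JetBundle m Q) (z : LegendreBundle m Q) :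
    TangentSpace (LModel m) z →L[ℝ] ℝ :=
  (LegendreBundle.mom z).comp
      ((ContinuousLinearMap.snd ℝ ℝ (Vel m)).comp
        (projTangent z : TangentSpace (LModel m) z →L[ℝ] ℝ × Vel m))
    - LegendreBundle.mom z (JetBundle.vel (Φ z)) • dtForm z

/-- `H` is weakly associated with `L = ℒ dt`: `L̂ ∘ Ĥ ∘ L̂ = L̂`, and `H = H_Ĥ + Ĥ^*L` at the points
of the Lagrangian constraint space. -/
def IsWeaklyAssociated (H : HamiltonianForm m Q) (ℒ : JetBundle m Q → ℝ) : Prop :=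
  legendreMap ℒ ∘ H.hamiltonianMap ∘ legendreMap ℒ = legendreMap ℒ ∧
  ∀ z ∈ constraintSpace ℒ,
    H.form z = formOfMap H.hamiltonianMap z + ℒ (H.hamiltonianMap z) • dtForm z

/-- The section `r` of `V^*Q → ℝ` over `U` satisfies the Hamilton equations
`q^j_t = ∂^j ℋ`, `p_tj = -∂_j ℋ`. -/
def IsHamiltonSolution (H : HamiltonianForm m Q) (U : Set ℝ) (r : ℝ → LegendreBundle m Q) : Prop :=
  IsSectionOn (LModel m) (fun z : LegendreBundle m Q => time m z.proj) r U ∧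
  ∀ i : atlas (ℝ × Vel m) Q, ∀ t ∈ U, (r t).proj ∈ i.1.source → ∀ j : Fin m,
    deriv (fun s => (legCoord i (r s)).1.2 j) t
      = fderiv ℝ (H.hamiltonianIn i) (legCoord i (r t)) (0, basisCovec j) ∧
    deriv (fun s => (legCoord i (r s)).2 (basisVec j)) t
      = - fderiv ℝ (H.hamiltonianIn i) (legCoord i (r t)) ((0, basisVec j), 0)

end TimeMech

end

/-! In a bundle chart write `V = ∂ℋ/∂p` and `π = ∂ℒ/∂q_t`. Weak association gives two facts on
`N_L`: the Legendre map undoes `Ĥ`, so `p = π(t, q, V)`, and the energy relation `ℋ = p V - ℒ(t, q,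
V)` holds.

The energy relation may only be differentiated along `N_L`. Fixing a velocity `v` and moving the
base point `y`, the points `(y, π(y, v))` stay in `N_L`, and for `v = V(z)` they pass through `z`.
In the derivative along this family the variation of `p` cancels because `∂ℋ/∂p = V`, and the
variation of `V` cancels because `∂ℒ/∂q_t` at `V` is `p`. What remains is `∂ℋ/∂q = -∂ℒ/∂q ∘ Ĥ` on
`N_L` (`fderiv_base_eq_neg_of_energy`, `IsWeaklyAssociated.fderiv_hamiltonianIn`).

The first Hamilton equation says that `Ĥ ∘ r` is the first jet of `c`. Hence `p_j = π_j` along this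
jet, and the second Hamilton equation turns `dp_j/dt` into `∂ℒ/∂q^j`: this is the Lagrange equation
(`IsHamiltonSolution.lagrange_equation`). Since `Ĥ ∘ r` is a jet prolongation, the differences `q̂_t
- q_t` vanish, and the Cartan equations reduce to the Lagrange equations.

The remaining work is chart independence: fibre coordinates are stored in the preferred chart of the
base point, whereas the equations are stated in every bundle chart. The affine shift of velocities
between charts matches the term linear in `p` that `ℋ` acquires. -/

noncomputable section

namespace TimeMech

/-! ### Differentiating the energy relation along the image of the fibre derivative -/

section Calculus

variable {B E : Type*} [NormedAddCommGroup B] [NormedSpace ℝ B] [NormedAddCommGroup E]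
  [NormedSpace ℝ E]

/-- The fibre derivative of a function of `(y, v)` with respect to `v`. -/
def fibreDeriv (L : B × E → ℝ) (w : B × E) : E →L[ℝ] ℝ :=
  (fderiv ℝ L w).comp (ContinuousLinearMap.inr ℝ B E)

theorem fibreDeriv_apply (L : B × E → ℝ) (w : B × E) (v : E) :
    fibreDeriv L w v = fderiv ℝ L w (0, v) := rfl

theorem contDiffAt_fibreDeriv {L : B × E → ℝ} {w : B × E} {n n' : WithTop ℕ∞}
    (hL : ContDiffAt ℝ n' L w) (hn : n + 1 ≤ n') : ContDiffAt ℝ n (fibreDeriv L) w :=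
  (hL.fderiv_right hn).clm_comp contDiffAt_const

/-- If `h (y, p) = p (V) - L (y, V)` with `V = ∂h/∂p` on the image of the fibre derivative of `L`,
then the base derivatives of `h` and `L` are opposite at corresponding points. -/
theorem fderiv_base_eq_neg_of_energy {L : B × E → ℝ} {h : B × (E →L[ℝ] ℝ) → ℝ}
    {V : B × (E →L[ℝ] ℝ) → E} {y : B} {v : E}
    (hL : ContDiffAt ℝ 2 L (y, v))
    (hL' : DifferentiableAt ℝ L (y, V (y, fibreDeriv L (y, v))))
    (hh : DifferentiableAt ℝ h (y, fibreDeriv L (y, v)))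
    (hV : DifferentiableAt ℝ V (y, fibreDeriv L (y, v)))
    (hVh : ∀ p, fderiv ℝ h (y, fibreDeriv L (y, v)) (0, p) = p (V (y, fibreDeriv L (y, v))))
    (hfix : fibreDeriv L (y, V (y, fibreDeriv L (y, v))) = fibreDeriv L (y, v))
    (henergy : ∀ᶠ y' in 𝓝 y, h (y', fibreDeriv L (y', v)) =
      fibreDeriv L (y', v) (V (y', fibreDeriv L (y', v))) - L (y', V (y', fibreDeriv L (y', v))))
    (b : B) :
    fderiv ℝ h (y, fibreDeriv L (y, v)) (b, 0) =
      - fderiv ℝ L (y, V (y, fibreDeriv L (y, v))) (b, 0) := by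
  have hpi : DifferentiableAt ℝ (fibreDeriv L) (y, v) :=
    (contDiffAt_fibreDeriv (n := 1) hL (by norm_num)).differentiableAt (by simp)
  -- The velocity `v` is frozen while the base point moves, so that the momentum stays in the image
  -- of the fibre derivative, where the energy relation is available.
  obtain ⟨P', hP⟩ : ∃ P', HasFDerivAt (fun y' : B => fibreDeriv L (y', v)) P' y :=
    ⟨_, hpi.hasFDerivAt.comp (f := fun y' : B => (y', v)) y (hasFDerivAt_prodMk_left y v)⟩
  have hz := (hasFDerivAt_id (𝕜 := ℝ) y).prodMk hP
  -- Away from `y` the velocity `V` along this family need not be `v`, so its variation `X'` has to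
  -- be tracked.
  obtain ⟨X', hX⟩ : ∃ X', HasFDerivAt (fun y' : B => V (y', fibreDeriv L (y', v))) X' y :=
    ⟨_, hV.hasFDerivAt.comp (f := fun y' : B => (y', fibreDeriv L (y', v))) y hz⟩
  have h1 : HasFDerivAt (fun y' : B => h (y', fibreDeriv L (y', v))) _ y :=
    hh.hasFDerivAt.comp y hz
  have h2 : HasFDerivAt (fun y' : B => L (y', V (y', fibreDeriv L (y', v)))) _ y :=
    hL'.hasFDerivAt.comp y ((hasFDerivAt_id (𝕜 := ℝ) y).prodMk hX)
  have h3 := ((hP.clm_apply hX).sub h2).congr_of_eventuallyEq henergy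
  have h4 := DFunLike.congr_fun (h1.unique h3) b
  simp only [ContinuousLinearMap.comp_apply, ContinuousLinearMap.prod_apply,
    sub_apply, add_apply, ContinuousLinearMap.flip_apply,
    ContinuousLinearMap.id_apply] at h4
  have e1 : (b, P' b) = (b, 0) + (0, P' b) := by simp
  have e2 : (b, X' b) = (b, 0) + (0, X' b) := by simp
  -- The terms in `P' b` agree on both sides because `∂h/∂p` is evaluation at `V`; those in `X' b`
  -- cancel because `∂L/∂v` at `V` is the momentum itself.
  rw [e1, e2, map_add, map_add, hVh, ← fibreDeriv_apply L _ (X' b), hfix] at h4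
  linarith

end Calculus

variable {m : ℕ} {Q : Type*} [TopologicalSpace Q] [ChartedSpace (ℝ × Vel m) Q]
  [IsManifold (QModel m) ∞ Q]

/-! ### Bundle charts of the configuration space and their Jacobians -/

section Charts

theorem contMDiffAt_jac (i j : atlas (ℝ × Vel m) Q) {x : Q} (hi : x ∈ i.1.source)
    (hj : x ∈ j.1.source) :
    ContMDiffAt (QModel m) 𝓘(ℝ, (ℝ × Vel m) →L[ℝ] (ℝ × Vel m)) ∞ (jac m Q i j) x :=
  (contMDiffOn_jac i j).contMDiffAt
    ((i.1.open_source.inter j.1.open_source).mem_nhds ⟨hi, hj⟩)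

theorem contMDiffAt_chart (i : atlas (ℝ × Vel m) Q) {x : Q} (hi : x ∈ i.1.source) :
    ContMDiffAt (QModel m) (QModel m) ∞ i.1 x :=
  contMDiffAt_of_mem_maximalAtlas (IsManifold.subset_maximalAtlas i.2) hi

theorem contMDiffAt_chart_symm (i : atlas (ℝ × Vel m) Q) {y : ℝ × Vel m} (hy : y ∈ i.1.target) :
    ContMDiffAt (QModel m) (QModel m) ∞ i.1.symm y :=
  contMDiffAt_symm_of_mem_maximalAtlas (IsManifold.subset_maximalAtlas i.2) hy

/-- The tangent map of an inverse chart, read in the preferred chart. -/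
theorem mfderiv_chart_symm (i : atlas (ℝ × Vel m) Q) {y : ℝ × Vel m} (hy : y ∈ i.1.target) :
    mfderiv 𝓘(ℝ, ℝ × Vel m) (QModel m) i.1.symm y =
      jac m Q i (achart (ℝ × Vel m) (i.1.symm y)) (i.1.symm y) := by
  have hd : MDifferentiableAt 𝓘(ℝ, ℝ × Vel m) (QModel m) i.1.symm y :=
    (contMDiffAt_chart_symm i hy).mdifferentiableAt (by simp)
  refine hd.mfderiv.trans ?_
  simp only [jac, tangentBundleCore_coordChange, writtenInExtChartAt, extChartAt,
    OpenPartialHomeomorph.extend, mfld_simps]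
  rw [i.1.right_inv hy]
  rfl

theorem jac_cancel (i j : atlas (ℝ × Vel m) Q) {x : Q} (hi : x ∈ i.1.source)
    (hj : x ∈ j.1.source) (w : ℝ × Vel m) : jac m Q j i x (jac m Q i j x w) = w := by
  rw [jac_comp i j i ⟨⟨hi, hj⟩, hi⟩, jac_self i hi]

end Charts

variable [FibredOverTime m Q]

theorem vertJac_cancel (i j : atlas (ℝ × Vel m) Q) {x : Q} (hi : x ∈ i.1.source)
    (hj : x ∈ j.1.source) (v : Vel m) : vertJac m Q j i x (vertJac m Q i j x v) = v := by
  rw [vertJac_comp i j i ⟨⟨hi, hj⟩, hi⟩, vertJac_apply, jac_self i hi]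

/-! ### Bundle coordinates on the jet manifold -/

section JetCoordinates

/-- A jet stores its velocity in the preferred chart of its base point; the affine cocycle carries
it to chart `i`. -/
theorem jetCoord_snd (i : atlas (ℝ × Vel m) Q) (x : JetBundle m Q) :
    (jetCoord i x).2 = (jac m Q (achart (ℝ × Vel m) x.proj) i x.proj (1, JetBundle.vel x)).2 :=
  rfl

theorem jetPoint_proj (i : atlas (ℝ × Vel m) Q) (w : (ℝ × Vel m) × Vel m) :
    (jetPoint i w).proj = i.1.symm w.1 := rfl

theorem jetPoint_jetCoord (i : atlas (ℝ × Vel m) Q) {x : JetBundle m Q}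
    (hx : x.proj ∈ i.1.source) : jetPoint i (jetCoord i x) = x := by
  have h : ((jetCore m Q).localTriv i).toOpenPartialHomeomorph.symm
      ((jetCore m Q).localTriv i x) = x :=
    ((jetCore m Q).localTriv i).toOpenPartialHomeomorph.left_inv
      (((jetCore m Q).mem_localTriv_source i x).2 hx)
  unfold jetPoint jetCoord
  rw [i.1.left_inv hx]
  exact h

theorem jetCoord_jetPoint (i : atlas (ℝ × Vel m) Q) {w : (ℝ × Vel m) × Vel m}
    (hw : w.1 ∈ i.1.target) : jetCoord i (jetPoint i w) = w := by
  have h : (jetCore m Q).localTriv i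
      (((jetCore m Q).localTriv i).toOpenPartialHomeomorph.symm (i.1.symm w.1, w.2)) =
        (i.1.symm w.1, w.2) :=
    ((jetCore m Q).localTriv i).toOpenPartialHomeomorph.right_inv
      (((jetCore m Q).mem_localTriv_target i _).2 (i.1.map_target hw))
  refine Prod.ext (i.1.right_inv hw) ?_
  have h2 := congrArg Prod.snd h
  exact h2

/-- The fibre part is compared with the single chart `k` preferred at the base point of `w`, where
it is the smooth expression `jac i k` applied to `(1, q_t)`. -/
theorem contMDiffAt_jetPoint (i : atlas (ℝ × Vel m) Q) {w : (ℝ × Vel m) × Vel m}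
    (hw : w.1 ∈ i.1.target) :
    ContMDiffAt 𝓘(ℝ, (ℝ × Vel m) × Vel m) (JModel m) ∞ (jetPoint (m := m) (Q := Q) i) w := by
  have hs : ContMDiffAt 𝓘(ℝ, (ℝ × Vel m) × Vel m) (QModel m) ∞
      (fun w : (ℝ × Vel m) × Vel m => i.1.symm w.1) w :=
    (contMDiffAt_chart_symm i hw).comp w contDiff_fst.contDiffAt.contMDiffAt
  refine contMDiffAt_totalSpace.2 ⟨hs, ?_⟩
  set k : atlas (ℝ × Vel m) Q := achart (ℝ × Vel m) (i.1.symm w.1)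
  have hk : i.1.symm w.1 ∈ k.1.source := mem_chart_source _ _
  have hj := (contMDiffAt_jac i k (i.1.map_target hw) hk).comp w hs
  have h2 : ContMDiffAt 𝓘(ℝ, (ℝ × Vel m) × Vel m) 𝓘(ℝ, Vel m) ∞
      (fun w : (ℝ × Vel m) × Vel m => (jac m Q i k (i.1.symm w.1) (1, w.2)).2) w :=
    ((hj.contDiffAt).clm_apply
      (contDiffAt_const.prodMk contDiffAt_snd)).snd.contMDiffAt
  refine h2.congr_of_eventuallyEq ?_
  have ht : ∀ᶠ w' in 𝓝 w, w'.1 ∈ i.1.target :=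
    continuousAt_fst.eventually (i.1.open_target.mem_nhds hw)
  have hk' : ∀ᶠ w' in 𝓝 w, i.1.symm w'.1 ∈ k.1.source :=
    hs.continuousAt.eventually (k.1.open_source.mem_nhds hk)
  filter_upwards [ht, hk'] with w' h1 h2
  -- The preferred chart of the moving point may jump, but the cocycle identity eliminates it.
  exact (jetCore m Q).coordChange_comp i (achart (ℝ × Vel m) (i.1.symm w'.1)) k (i.1.symm w'.1)
    ⟨⟨i.1.map_target h1, mem_chart_source _ _⟩, h2⟩ w'.2

theorem contDiffAt_lagrangianIn {ℒ : JetBundle m Q → ℝ}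
    (hℒ : ContMDiff (JModel m) 𝓘(ℝ, ℝ) ∞ ℒ) (i : atlas (ℝ × Vel m) Q)
    {w : (ℝ × Vel m) × Vel m} (hw : w.1 ∈ i.1.target) :
    ContDiffAt ℝ ∞ (lagrangianIn ℒ i) w :=
  ((hℒ _).comp w (contMDiffAt_jetPoint i hw)).contDiffAt

end JetCoordinates

/-! ### Bundle coordinates on the Legendre bundle -/

section MomentumCoordinates

theorem legCoord_snd (i : atlas (ℝ × Vel m) Q) (z : LegendreBundle m Q) :
    (legCoord i z).2 =
      (LegendreBundle.mom z).comp (vertJac m Q i (achart (ℝ × Vel m) z.proj) z.proj) := rfl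

theorem legPoint_legCoord (i : atlas (ℝ × Vel m) Q) {z : LegendreBundle m Q}
    (hz : z.proj ∈ i.1.source) : legPoint i (legCoord i z) = z := by
  have h : ((legendreCore m Q).localTriv i).toOpenPartialHomeomorph.symm
      ((legendreCore m Q).localTriv i z) = z :=
    ((legendreCore m Q).localTriv i).toOpenPartialHomeomorph.left_inv
      (((legendreCore m Q).mem_localTriv_source i z).2 hz)
  unfold legPoint legCoord
  rw [i.1.left_inv hz]
  exact h

theorem legCoord_legPoint (i : atlas (ℝ × Vel m) Q) {w : (ℝ × Vel m) × Mom m}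
    (hw : w.1 ∈ i.1.target) : legCoord i (legPoint (m := m) (Q := Q) i w) = w := by
  have h : (legendreCore m Q).localTriv i
      (((legendreCore m Q).localTriv i).toOpenPartialHomeomorph.symm (i.1.symm w.1, w.2)) =
        (i.1.symm w.1, w.2) :=
    ((legendreCore m Q).localTriv i).toOpenPartialHomeomorph.right_inv
      (((legendreCore m Q).mem_localTriv_target i _).2 (i.1.map_target hw))
  refine Prod.ext (i.1.right_inv hw) ?_
  have h2 := congrArg Prod.snd h
  exact h2

theorem memTrivializationAtlas_legendre (i : atlas (ℝ × Vel m) Q) :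
    MemTrivializationAtlas
      (((legendreCore m Q).localTriv i) : Trivialization (Mom m) (TotalSpace.proj :
        LegendreBundle m Q → Q)) :=
  ⟨⟨i, rfl⟩⟩

theorem contMDiffAt_legPoint (i : atlas (ℝ × Vel m) Q) {w : (ℝ × Vel m) × Mom m}
    (hw : w.1 ∈ i.1.target) :
    ContMDiffAt 𝓘(ℝ, (ℝ × Vel m) × Mom m) (LModel m) ∞ (legPoint (m := m) (Q := Q) i) w := by
  have hs : ContMDiffAt 𝓘(ℝ, (ℝ × Vel m) × Mom m) (QModel m) ∞
      (fun w : (ℝ × Vel m) × Mom m => i.1.symm w.1) w :=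
    (contMDiffAt_chart_symm i hw).comp w contDiff_fst.contDiffAt.contMDiffAt
  have := memTrivializationAtlas_legendre (Q := Q) i
  have hsrc : legPoint i w ∈ ((legendreCore m Q).localTriv i).source :=
    ((legendreCore m Q).mem_localTriv_source i _).2 (i.1.map_target hw)
  refine (Trivialization.contMDiffAt_iff hsrc).2 ⟨hs, ?_⟩
  refine (contDiff_snd (𝕜 := ℝ) (E := ℝ × Vel m)
    (F := Mom m)).contDiffAt.contMDiffAt.congr_of_eventuallyEq ?_
  have ht : ∀ᶠ w' in 𝓝 w, w'.1 ∈ i.1.target :=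
    continuousAt_fst.eventually (i.1.open_target.mem_nhds hw)
  filter_upwards [ht] with w' h1
  exact congrArg Prod.snd (legCoord_legPoint (Q := Q) i h1)

theorem contMDiffAt_legCoord (i : atlas (ℝ × Vel m) Q) {z : LegendreBundle m Q}
    (hz : z.proj ∈ i.1.source) :
    ContMDiffAt (LModel m) 𝓘(ℝ, (ℝ × Vel m) × Mom m) ∞ (legCoord (m := m) (Q := Q) i) z := by
  have := memTrivializationAtlas_legendre (Q := Q) i
  have hsrc : z ∈ ((legendreCore m Q).localTriv i).source :=
    ((legendreCore m Q).mem_localTriv_source i _).2 hz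
  have h := (Trivialization.contMDiffAt_iff (n := ∞) (IB := QModel m) (IM := LModel m)
    (f := id) (x₀ := z) hsrc).1 contMDiffAt_id
  exact ((contMDiffAt_chart i hz).comp z h.1).prodMk_space h.2

end MomentumCoordinates

end TimeMech

/-! ### Hamiltonian form, Hamiltonian map, Legendre map and weak association in bundle charts -/

namespace TimeMech

/-- A linear functional on covectors is evaluation at the vector of its components. -/
theorem apply_toLp_eq {m : ℕ} (φ : Mom m →L[ℝ] ℝ) (p : Mom m) :
    p (WithLp.toLp 2 fun j : Fin m => φ (basisCovec j)) = φ p := by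
  have hp : p = ∑ j, p (basisVec j) • basisCovec j := by
    ext v
    conv_lhs => rw [← (EuclideanSpace.basisFun (Fin m) ℝ).sum_repr v]
    simp [mul_comm]
  conv_rhs => rw [hp]
  conv_lhs => rw [hp]
  simp [sum_apply]

variable {m : ℕ} {Q : Type*} [TopologicalSpace Q] [ChartedSpace (ℝ × Vel m) Q]
  [IsManifold (QModel m) ∞ Q] [FibredOverTime m Q]

/-- Tangent vectors of `Q` at the projection of a point lift to `V^*Q`. -/
theorem projTangent_surjective (z : LegendreBundle m Q) (u : ℝ × Vel m) :
    ∃ X : TangentSpace (LModel m) z, projTangent z X = u := by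
  obtain ⟨i, hz⟩ : ∃ i : atlas (ℝ × Vel m) Q, z.proj ∈ i.1.source :=
    ⟨achart (ℝ × Vel m) z.proj, mem_chart_source _ _⟩
  obtain ⟨w, hw, rfl⟩ : ∃ w, w.1 ∈ i.1.target ∧ legPoint i w = z :=
    ⟨legCoord i z, i.1.map_source hz, legPoint_legCoord i hz⟩
  have h1 : HasMFDerivAt 𝓘(ℝ, (ℝ × Vel m) × Mom m) (LModel m) (legPoint i) w
      (mfderiv 𝓘(ℝ, (ℝ × Vel m) × Mom m) (LModel m) (legPoint i) w) :=
    ((contMDiffAt_legPoint i hw).mdifferentiableAt (by simp)).hasMFDerivAt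
  have h2 : HasMFDerivAt (LModel m) (QModel m) (fun y : LegendreBundle m Q => y.proj)
      (legPoint i w) (projTangent (legPoint i w)) :=
    ((contMDiff_proj _ _).mdifferentiableAt (n := ∞) (by simp)).hasMFDerivAt
  have h3 := h2.comp w h1
  have h4 : HasMFDerivAt (QModel m) (QModel m) i.1.symm w.1
      (mfderiv 𝓘(ℝ, ℝ × Vel m) (QModel m) i.1.symm w.1) :=
    ((contMDiffAt_chart_symm i hw).mdifferentiableAt (by simp)).hasMFDerivAt
  have h5 := h4.comp w
    (hasFDerivAt_fst (𝕜 := ℝ) (E := ℝ × Vel m) (F := Mom m) (p := w)).hasMFDerivAt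
  have h6 := hasMFDerivAt_unique h3 h5
  set k := achart (ℝ × Vel m) (i.1.symm w.1)
  -- The lift has, in chart `i`, the coordinates of `u` as base part and zero momentum part; the two
  -- Jacobians then cancel after projection.
  refine ⟨mfderiv 𝓘(ℝ, (ℝ × Vel m) × Mom m) (LModel m) (legPoint i) w
    ((jac m Q k i (i.1.symm w.1) u, 0) : (ℝ × Vel m) × Mom m), ?_⟩
  refine (DFunLike.congr_fun h6 ((jac m Q k i (i.1.symm w.1) u, 0) : (ℝ × Vel m) × Mom m)).trans ?_
  rw [mfderiv_chart_symm i hw]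
  exact jac_cancel k i (mem_chart_source _ _) (i.1.map_target hw) u

namespace HamiltonianForm

variable (H : HamiltonianForm m Q)

/-- The covector `h(z)` in the components of the preferred chart. -/
def covec (z : LegendreBundle m Q) : (ℝ × Vel m) →L[ℝ] ℝ := H.cov z

/-- Being a section of `zeta`, `h` restricts to the momentum on vertical vectors; only its value on
`∂_t` is free. -/
theorem covec_apply (z : LegendreBundle m Q) (a : ℝ) (b : Vel m) :
    H.covec z (a, b) = a * H.covec z (1, 0) + LegendreBundle.mom z b := by
  have h : ∀ z' : LegendreBundle m Q, z' = z → z'.proj = z.proj →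
      LegendreBundle.mom z' = LegendreBundle.mom z := by
    rintro _ rfl -; rfl
  have h2 : H.covec z (0, b) = LegendreBundle.mom z b :=
    DFunLike.congr_fun (h _ (H.zeta_cov z) rfl) b
  have h3 : ((a, b) : ℝ × Vel m) = a • (1, 0) + (0, b) := by simp
  rw [h3, map_add, map_smul, h2, smul_eq_mul]

theorem hamiltonianIn_eq (i : atlas (ℝ × Vel m) Q) {w : (ℝ × Vel m) × Mom m}
    (hw : w.1 ∈ i.1.target) : H.hamiltonianIn i w = - H.covec (legPoint i w)
      (jac m Q i (achart (ℝ × Vel m) (i.1.symm w.1)) (i.1.symm w.1) (1, 0)) := by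
  rw [← mfderiv_chart_symm i hw]
  rfl

/-- The Hamiltonian in a chart, in terms of the preferred chart at the point. -/
theorem hamiltonianIn_legCoord (i : atlas (ℝ × Vel m) Q) {z : LegendreBundle m Q}
    (hz : z.proj ∈ i.1.source) : H.hamiltonianIn i (legCoord i z) = - H.covec z (1, 0)
      - LegendreBundle.mom z (jac m Q i (achart (ℝ × Vel m) z.proj) z.proj (1, 0)).2 := by
  have hz' : i.1.symm (legCoord i z).1 = z.proj := i.1.left_inv hz
  rw [hamiltonianIn_eq H i (i.1.map_source hz), legPoint_legCoord i hz, hz']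
  -- Transitions preserve the time component, so `∂_t` of chart `i` is `(1, b)` in the preferred
  -- chart; the vertical part `b` produces the term linear in the momentum.
  have h1 := jac_fst i (achart (ℝ × Vel m) z.proj) hz (mem_chart_source _ _) (1, 0)
  rw [← Prod.mk.eta (p := jac m Q i (achart (ℝ × Vel m) z.proj) z.proj (1, 0)), h1, covec_apply]
  ring

/-- Up to sign, the Hamiltonian is the pairing of two smooth objects over `Q`: the covector `h` at
`legPoint i w` and the coordinate field `∂_t` of chart `i`. -/
theorem contDiffAt_hamiltonianIn (i : atlas (ℝ × Vel m) Q) {w : (ℝ × Vel m) × Mom m}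
    (hw : w.1 ∈ i.1.target) : ContDiffAt ℝ ∞ (H.hamiltonianIn i) w := by
  have hs : ContMDiffAt 𝓘(ℝ, (ℝ × Vel m) × Mom m) (QModel m) ∞
      (fun w : (ℝ × Vel m) × Mom m => i.1.symm w.1) w :=
    (contMDiffAt_chart_symm i hw).comp w contDiff_fst.contDiffAt.contMDiffAt
  have h1 : ContMDiffAt 𝓘(ℝ, (ℝ × Vel m) × Mom m) (CModel m) ∞
      (fun w => (⟨i.1.symm w.1, H.cov (legPoint i w)⟩ : CotangentBundle m Q)) w :=
    (H.smooth _).comp w (contMDiffAt_legPoint i hw)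
  have h2 : ContMDiffAt 𝓘(ℝ, (ℝ × Vel m) × Mom m) (QModel m).tangent ∞
      (fun w => (⟨i.1.symm w.1, mfderiv 𝓘(ℝ, ℝ × Vel m) (QModel m) i.1.symm w.1
        ((1, 0) : ℝ × Vel m)⟩ : TangentBundle (QModel m) Q)) w := by
    refine contMDiffAt_totalSpace.2 ⟨hs, ?_⟩
    set k : atlas (ℝ × Vel m) Q := achart (ℝ × Vel m) (i.1.symm w.1)
    have hk : i.1.symm w.1 ∈ k.1.source := mem_chart_source _ _
    have hj := (contMDiffAt_jac i k (i.1.map_target hw) hk).comp w hs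
    have h2 : ContMDiffAt 𝓘(ℝ, (ℝ × Vel m) × Mom m) 𝓘(ℝ, ℝ × Vel m) ∞
        (fun w : (ℝ × Vel m) × Mom m => jac m Q i k (i.1.symm w.1) (1, 0)) w :=
      (hj.contDiffAt.clm_apply contDiffAt_const).contMDiffAt
    refine h2.congr_of_eventuallyEq ?_
    have ht : ∀ᶠ w' in 𝓝 w, w'.1 ∈ i.1.target :=
      continuousAt_fst.eventually (i.1.open_target.mem_nhds hw)
    have hk' : ∀ᶠ w' in 𝓝 w, i.1.symm w'.1 ∈ k.1.source :=
      hs.continuousAt.eventually (k.1.open_source.mem_nhds hk)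
    filter_upwards [ht, hk'] with w' h1 h2
    rw [mfderiv_chart_symm i h1]
    exact jac_comp i (achart (ℝ × Vel m) (i.1.symm w'.1)) k
      ⟨⟨i.1.map_target h1, mem_chart_source _ _⟩, h2⟩ _
  have h3 := ContMDiffAt.clm_bundle_apply (E₁ := TangentSpace (QModel m)) (E₂ := Trivial Q ℝ)
    h1 h2
  exact ((contMDiffAt_totalSpace.1 h3).2.contDiffAt).neg

/-- The velocity `∂ℋ/∂p` in the bundle chart `i`. -/
def velocityIn (i : atlas (ℝ × Vel m) Q) (w : (ℝ × Vel m) × Mom m) : Vel m :=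
  WithLp.toLp 2 fun j : Fin m => fderiv ℝ (H.hamiltonianIn i) w (0, basisCovec j)

theorem apply_velocityIn (i : atlas (ℝ × Vel m) Q) (w : (ℝ × Vel m) × Mom m) (p : Mom m) :
    p (H.velocityIn i w) = fderiv ℝ (H.hamiltonianIn i) w (0, p) :=
  apply_toLp_eq ((fderiv ℝ (H.hamiltonianIn i) w).comp
    (ContinuousLinearMap.inr ℝ (ℝ × Vel m) (Mom m))) p

theorem contDiffAt_velocityIn (i : atlas (ℝ × Vel m) Q) {w : (ℝ × Vel m) × Mom m}
    (hw : w.1 ∈ i.1.target) : ContDiffAt ℝ ∞ (H.velocityIn i) w := by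
  have h := (H.contDiffAt_hamiltonianIn i hw).fderiv_right (m := ∞) (by simp)
  rw [contDiffAt_euclidean]
  exact fun j => h.clm_apply contDiffAt_const

theorem apply_vel_hamiltonianMap (z : LegendreBundle m Q) (p : Mom m) :
    p (JetBundle.vel (H.hamiltonianMap z)) =
      fderiv ℝ (fun p : Mom m => - H.covec ⟨z.proj, p⟩ (1, 0)) (LegendreBundle.mom z) p :=
  apply_toLp_eq (fderiv ℝ (fun p : Mom m => - H.covec ⟨z.proj, p⟩ (1, 0))
    (LegendreBundle.mom z)) p

/-- This is the chart independence of `Ĥ`. With `b` the vertical part of `∂_t` of chart `i`, the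
preferred-chart Hamiltonian is that of chart `i` plus `p(b)`. Its `p`-gradient is therefore shifted
by `b`, exactly as velocities are under the affine cocycle. -/
theorem jetCoord_hamiltonianMap (i : atlas (ℝ × Vel m) Q) {z : LegendreBundle m Q}
    (hz : z.proj ∈ i.1.source) :
    jetCoord i (H.hamiltonianMap z) = (i.1 z.proj, H.velocityIn i (legCoord i z)) := by
  refine Prod.ext rfl ?_
  rw [jetCoord_snd]
  set V := JetBundle.vel (H.hamiltonianMap z)
  change (jac m Q (achart (ℝ × Vel m) z.proj) i z.proj (1, V)).2 = H.velocityIn i (legCoord i z)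
  set k : atlas (ℝ × Vel m) Q := achart (ℝ × Vel m) z.proj
  have hk : z.proj ∈ k.1.source := mem_chart_source _ _
  set b := (jac m Q i k z.proj (1, 0)).2
  have hb : jac m Q i k z.proj (1, 0) = (1, b) := Prod.ext (jac_fst i k hz hk _) rfl
  -- The affine change of velocities sends `b` to `0`, so it is `vertJac` applied to the difference
  -- from `b`.
  have hV : (jac m Q k i z.proj (1, V)).2 = vertJac m Q k i z.proj (V - b) := by
    have h : ((1, V) : ℝ × Vel m) = jac m Q i k z.proj (1, 0) + (0, V - b) := by rw [hb]; simp
    rw [h, map_add, jac_cancel i k hz hk, vertJac_apply]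
    simp
  rw [hV]
  have hd : ∀ p : Mom m, p (V - b) = fderiv ℝ (H.hamiltonianIn i) (legCoord i z)
      (0, p.comp (vertJac m Q i k z.proj)) := by
    intro p
    set A := (ContinuousLinearMap.compL ℝ (Vel m) (Vel m) ℝ).flip (vertJac m Q i k z.proj)
    have h1 : (fun p : Mom m => - H.covec ⟨z.proj, p⟩ (1, 0)) =
        fun p : Mom m => H.hamiltonianIn i (i.1 z.proj, A p) + p b := by
      funext p
      have := H.hamiltonianIn_legCoord i (z := ⟨z.proj, p⟩) hz
      change H.hamiltonianIn i (i.1 z.proj, A p) = _ - p b at this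
      rw [this]; ring
    have h2 : HasFDerivAt (fun p : Mom m => H.hamiltonianIn i (i.1 z.proj, A p)) _
        (LegendreBundle.mom z) :=
      ((H.contDiffAt_hamiltonianIn i (w := legCoord i z)
        (i.1.map_source hz)).differentiableAt (by simp)).hasFDerivAt.comp
        (g := H.hamiltonianIn i) (f := fun p : Mom m => (i.1 z.proj, A p)) (LegendreBundle.mom z)
        ((hasFDerivAt_const (i.1 z.proj) (LegendreBundle.mom z)).prodMk A.hasFDerivAt)
    have h3 := h2.add ((ContinuousLinearMap.apply ℝ ℝ b).hasFDerivAt (x := LegendreBundle.mom z))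
    have h4 : fderiv ℝ (fun p : Mom m => - H.covec ⟨z.proj, p⟩ (1, 0)) (LegendreBundle.mom z) p =
        fderiv ℝ (H.hamiltonianIn i) (legCoord i z) (0, A p) + p b := by
      rw [h1]
      exact DFunLike.congr_fun h3.fderiv p
    rw [map_sub, H.apply_vel_hamiltonianMap z p, h4, add_sub_cancel_right]
    rfl
  refine PiLp.ext fun j => ?_
  -- This test covector is chosen so that pulling it back by the inverse transition leaves the
  -- coordinate covector `j`.
  have h5 := hd ((basisCovec j).comp (vertJac m Q k i z.proj))
  have h6 : ((basisCovec j).comp (vertJac m Q k i z.proj)).comp (vertJac m Q i k z.proj) =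
      (basisCovec j : Mom m) := by
    ext v
    simp only [ContinuousLinearMap.comp_apply, vertJac_cancel i k hz hk]
  rw [h6] at h5
  exact h5

/-- The pointwise definition uses a chart that jumps with the base point. Near `z` one fixed chart
suffices, in which the map is `(y, p) ↦ (y, ∂ℋ/∂p)`. -/
theorem contMDiff_hamiltonianMap : ContMDiff (LModel m) (JModel m) ∞ H.hamiltonianMap := by
  intro z
  set i : atlas (ℝ × Vel m) Q := achart (ℝ × Vel m) z.proj
  have hz : z.proj ∈ i.1.source := mem_chart_source _ _
  have hc := contMDiffAt_legCoord i hz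
  have h1 : ContDiffAt ℝ ∞ (fun w : (ℝ × Vel m) × Mom m => (w.1, H.velocityIn i w))
      (legCoord i z) :=
    contDiffAt_fst.prodMk (H.contDiffAt_velocityIn i (i.1.map_source hz))
  have h2 := (contMDiffAt_jetPoint (Q := Q) i (w := (i.1 z.proj, H.velocityIn i (legCoord i z)))
    (i.1.map_source hz)).comp z (h1.contMDiffAt.comp z hc)
  refine h2.congr_of_eventuallyEq ?_
  have hs : ∀ᶠ z' : LegendreBundle m Q in 𝓝 z, z'.proj ∈ i.1.source :=
    (contMDiff_proj (n := ∞) (IB := QModel m)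
      (legendreCore m Q).Fiber).continuous.continuousAt.eventually
      (i.1.open_source.mem_nhds hz)
  filter_upwards [hs] with z' hz'
  have h3 : (H.hamiltonianMap z').proj ∈ i.1.source := hz'
  rw [← jetPoint_jetCoord i h3, H.jetCoord_hamiltonianMap i hz']
  rfl

/-- The section `h` covers the identity of `Q`, so by the chain rule the tangent of `T^*Q → Q` after
that of `h` is the tangent of `π_Q`; the Liouville form then just evaluates `h(z)`. -/
theorem form_apply (z : LegendreBundle m Q) (X : TangentSpace (LModel m) z) :
    H.form z X = H.covec z (projTangent z X) := by
  have h1 : HasMFDerivAt (LModel m) (CModel m) H.sec z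
      (mfderiv (LModel m) (CModel m) H.sec z) :=
    ((H.smooth z).mdifferentiableAt (by simp)).hasMFDerivAt
  have h2 : HasMFDerivAt (CModel m) (QModel m) (fun β : CotangentBundle m Q => β.proj)
      (H.sec z) (mfderiv (CModel m) (QModel m) (fun β : CotangentBundle m Q => β.proj) (H.sec z)) :=
    ((contMDiff_proj _ _).mdifferentiableAt (n := ∞) (by simp)).hasMFDerivAt
  have h3 := (h2.comp z h1).mfderiv
  exact congrArg (H.covec z) (DFunLike.congr_fun h3 X).symm

end HamiltonianForm

/-- On a fibre the chart change of velocities is affine with linear part `vertJac`. The chain rule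
thus transforms the fibre derivative by the transpose, which is the cocycle of the momenta. -/
theorem legCoord_legendreMap {ℒ : JetBundle m Q → ℝ} (hℒ : ContMDiff (JModel m) 𝓘(ℝ, ℝ) ∞ ℒ)
    (i : atlas (ℝ × Vel m) Q) {x : JetBundle m Q} (hx : x.proj ∈ i.1.source) :
    legCoord i (legendreMap ℒ x) =
      (i.1 x.proj, fibreDeriv (lagrangianIn ℒ i) (jetCoord i x)) := by
  refine Prod.ext rfl ?_
  rw [legCoord_snd]
  set k : atlas (ℝ × Vel m) Q := achart (ℝ × Vel m) x.proj
  have hk : x.proj ∈ k.1.source := mem_chart_source _ _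
  have h1 : (fun v : Vel m => ℒ ⟨x.proj, v⟩) = fun v : Vel m =>
      lagrangianIn ℒ i (i.1 x.proj, (jac m Q k i x.proj (1, v)).2) := by
    funext v
    exact congrArg ℒ (jetPoint_jetCoord i (x := ⟨x.proj, v⟩) hx).symm
  have h0 : HasFDerivAt (fun v : Vel m => (jac m Q k i x.proj (1, v)).2)
      (vertJac m Q k i x.proj) (JetBundle.vel x) :=
    ((jac m Q k i x.proj).hasFDerivAt.comp (JetBundle.vel x)
      (hasFDerivAt_prodMk_right (𝕜 := ℝ) (1 : ℝ) (JetBundle.vel x))).snd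
  have h2 : HasFDerivAt (fun v : Vel m =>
      lagrangianIn ℒ i (i.1 x.proj, (jac m Q k i x.proj (1, v)).2)) _ (JetBundle.vel x) :=
    ((contDiffAt_lagrangianIn hℒ i (w := jetCoord i x)
      (i.1.map_source hx)).differentiableAt (by simp)).hasFDerivAt.comp (g := lagrangianIn ℒ i)
      (f := fun v : Vel m => (i.1 x.proj, (jac m Q k i x.proj (1, v)).2)) (JetBundle.vel x)
      ((hasFDerivAt_const (i.1 x.proj) (JetBundle.vel x)).prodMk h0)
  ext v
  change fderiv ℝ (fun v : Vel m => ℒ ⟨x.proj, v⟩) (JetBundle.vel x) (vertJac m Q i k x.proj v) = _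
  rw [h1, h2.fderiv]
  simp only [ContinuousLinearMap.comp_apply, ContinuousLinearMap.prod_apply,
    vertJac_cancel i k hx hk]
  rfl

/-- The energy relation on the constraint space, in the preferred chart. -/
theorem IsWeaklyAssociated.neg_covec {H : HamiltonianForm m Q} {ℒ : JetBundle m Q → ℝ}
    (hH : IsWeaklyAssociated H ℒ) {z : LegendreBundle m Q} (hz : z ∈ constraintSpace ℒ) :
    - H.covec z (1, 0) =
      LegendreBundle.mom z (JetBundle.vel (H.hamiltonianMap z)) - ℒ (H.hamiltonianMap z) := by
  -- Both forms are evaluated on a lift of `∂_t`: there `dt = 1` and `dq = 0`, so only the energy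
  -- terms survive.
  obtain ⟨X, hX⟩ := projTangent_surjective z (1, 0)
  have h := DFunLike.congr_fun (hH.2 z hz) X
  rw [H.form_apply, hX] at h
  have hdt : dtForm z X = 1 := congrArg Prod.fst hX
  have h2 : formOfMap H.hamiltonianMap z X =
      LegendreBundle.mom z (projTangent z X : ℝ × Vel m).2
        - LegendreBundle.mom z (JetBundle.vel (H.hamiltonianMap z)) * dtForm z X := rfl
  have h3 : (formOfMap H.hamiltonianMap z + ℒ (H.hamiltonianMap z) • dtForm z) X =
    formOfMap H.hamiltonianMap z X + ℒ (H.hamiltonianMap z) * dtForm z X := rfl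
  rw [h3, h2, hdt, hX] at h
  have h4 : LegendreBundle.mom z ((1, 0) : ℝ × Vel m).2 = 0 := map_zero _
  rw [h4] at h
  linarith

/-- The Legendre map inverts the Hamiltonian map on the constraint space. -/
theorem IsWeaklyAssociated.legendreMap_hamiltonianMap {H : HamiltonianForm m Q}
    {ℒ : JetBundle m Q → ℝ} (hH : IsWeaklyAssociated H ℒ) {z : LegendreBundle m Q}
    (hz : z ∈ constraintSpace ℒ) : legendreMap ℒ (H.hamiltonianMap z) = z := by
  obtain ⟨x, rfl⟩ := hz
  exact congrFun hH.1 x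

/-- The energy relation `ℋ = p_i V^i - ℒ` on the constraint space, in a bundle chart. -/
theorem IsWeaklyAssociated.hamiltonianIn_legCoord {H : HamiltonianForm m Q}
    {ℒ : JetBundle m Q → ℝ} (hH : IsWeaklyAssociated H ℒ) (i : atlas (ℝ × Vel m) Q)
    {z : LegendreBundle m Q} (hz : z ∈ constraintSpace ℒ) (hi : z.proj ∈ i.1.source) :
    H.hamiltonianIn i (legCoord i z) = (legCoord i z).2 (H.velocityIn i (legCoord i z)) -
      lagrangianIn ℒ i (i.1 z.proj, H.velocityIn i (legCoord i z)) := by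
  have hi' : (H.hamiltonianMap z).proj ∈ i.1.source := hi
  have hV : H.velocityIn i (legCoord i z) = (jetCoord i (H.hamiltonianMap z)).2 := by
    rw [H.jetCoord_hamiltonianMap i hi]
  have hL : lagrangianIn ℒ i (i.1 z.proj, H.velocityIn i (legCoord i z)) =
      ℒ (H.hamiltonianMap z) := by
    rw [← H.jetCoord_hamiltonianMap i hi, lagrangianIn, jetPoint_jetCoord i hi']
  rw [hL, H.hamiltonianIn_legCoord i hi, hH.neg_covec hz, hV, jetCoord_snd, legCoord_snd]
  set V := JetBundle.vel (H.hamiltonianMap z)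
  set k : atlas (ℝ × Vel m) Q := achart (ℝ × Vel m) z.proj
  change _ = LegendreBundle.mom z (vertJac m Q i k z.proj (jac m Q k i z.proj (1, V)).2) - _
  have hk : z.proj ∈ k.1.source := mem_chart_source _ _
  -- Pulled back to the preferred chart, the velocity of chart `i` is `V` minus the vertical part of
  -- `∂_t`. This subtraction is the same correction that the Hamiltonian receives.
  have h1 : vertJac m Q i k z.proj (jac m Q k i z.proj (1, V)).2 =
      V - (jac m Q i k z.proj (1, 0)).2 := by
    have h : ((0 : ℝ), (jac m Q k i z.proj (1, V)).2) = jac m Q k i z.proj (1, V) - (1, 0) :=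
      Prod.ext (by rw [Prod.fst_sub, jac_fst k i hk hi]; simp) (by simp)
    rw [vertJac_apply, h, map_sub, jac_cancel k i hk hi]
    rfl
  rw [h1, map_sub]
  ring

end TimeMech

/-! ### Base derivatives of the Hamiltonian and the Lagrangian on the constraint space -/

namespace TimeMech

variable {m : ℕ} {Q : Type*} [TopologicalSpace Q] [ChartedSpace (ℝ × Vel m) Q]
  [IsManifold (QModel m) ∞ Q] [FibredOverTime m Q]
  {ℒ : JetBundle m Q → ℝ} {H : HamiltonianForm m Q}

/-- `∂ℋ/∂q = -∂ℒ/∂q` at corresponding points of the constraint space and of `J^1Q`. -/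
theorem IsWeaklyAssociated.fderiv_hamiltonianIn (hH : IsWeaklyAssociated H ℒ)
    (hℒ : ContMDiff (JModel m) 𝓘(ℝ, ℝ) ∞ ℒ) (i : atlas (ℝ × Vel m) Q) {z : LegendreBundle m Q}
    (hz : z ∈ constraintSpace ℒ) (hi : z.proj ∈ i.1.source) (b : ℝ × Vel m) :
    fderiv ℝ (H.hamiltonianIn i) (legCoord i z) (b, 0) =
      - fderiv ℝ (lagrangianIn ℒ i) (jetCoord i (H.hamiltonianMap z)) (b, 0) := by
  -- Since `z` is the Legendre image of `Ĥ(z)`, freezing the velocity `V(z)` gives a family in `N_L`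
  -- that passes through `z`.
  have hfix : legCoord i z = (i.1 z.proj,
      fibreDeriv (lagrangianIn ℒ i) (i.1 z.proj, H.velocityIn i (legCoord i z))) := by
    have h := legCoord_legendreMap hℒ i (x := H.hamiltonianMap z) hi
    rwa [hH.legendreMap_hamiltonianMap hz, H.jetCoord_hamiltonianMap i hi] at h
  have hy : i.1 z.proj ∈ i.1.target := i.1.map_source hi
  set v := H.velocityIn i (legCoord i z) with hv
  have hv' : H.velocityIn i (i.1 z.proj, fibreDeriv (lagrangianIn ℒ i) (i.1 z.proj, v)) = v := by
    rw [← hfix]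
  have key := fderiv_base_eq_neg_of_energy (L := lagrangianIn ℒ i) (h := H.hamiltonianIn i)
    (V := H.velocityIn i) (y := i.1 z.proj) (v := v)
    ((contDiffAt_lagrangianIn hℒ i hy).of_le (mod_cast le_top : ((2 : ℕ∞) : WithTop ℕ∞) ≤ ∞))
    ((contDiffAt_lagrangianIn hℒ i hy).differentiableAt (by simp))
    ((H.contDiffAt_hamiltonianIn i hy).differentiableAt (by simp))
    ((H.contDiffAt_velocityIn i hy).differentiableAt (by simp))
    (fun p => (H.apply_velocityIn i _ p).symm) (by rw [hv']) ?_ b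
  · rw [H.jetCoord_hamiltonianMap i hi, ← hv]
    rwa [hv', ← hfix] at key
  -- For nearby `y'` the point with momentum `π(y', v)` is the Legendre image of the jet `(y', v)`,
  -- hence lies in `N_L`, and the energy relation applies to it.
  · filter_upwards [i.1.open_target.mem_nhds hy] with y' hy'
    have hx : (jetPoint i (y', v)).proj ∈ i.1.source := i.1.map_target hy'
    have hc := legCoord_legendreMap hℒ i hx
    rw [jetCoord_jetPoint i (w := (y', v)) hy', jetPoint_proj, i.1.right_inv hy'] at hc
    have he := hH.hamiltonianIn_legCoord i (mem_range_self (jetPoint i (y', v))) hx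
    rw [hc] at he
    have hp : i.1 (legendreMap ℒ (jetPoint i (y', v))).proj = y' := i.1.right_inv hy'
    rwa [hp] at he

/-! ### Solutions: from the Hamilton equations to the Lagrange and Cartan equations -/

section Solutions

variable {U : Set ℝ} {r : ℝ → LegendreBundle m Q}

theorem IsHamiltonSolution.eventually_mem_source (hr : IsHamiltonSolution H U r) (hU : IsOpen U)
    (i : atlas (ℝ × Vel m) Q) {t : ℝ} (ht : t ∈ U) (hi : (r t).proj ∈ i.1.source) :
    ∀ᶠ s in 𝓝 t, s ∈ U ∧ (r s).proj ∈ i.1.source := by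
  have hc : ContinuousAt (fun s => (r s).proj) t :=
    (contMDiff_proj (n := ∞) (IB := QModel m)
      (legendreCore m Q).Fiber).continuous.continuousAt.comp
      (hr.1.1.contMDiffAt (hU.mem_nhds ht)).continuousAt
  exact Filter.Eventually.and (hU.mem_nhds ht) (hc.eventually (i.1.open_source.mem_nhds hi))

theorem IsHamiltonSolution.contDiffAt_legCoord (hr : IsHamiltonSolution H U r) (hU : IsOpen U)
    (i : atlas (ℝ × Vel m) Q) {t : ℝ} (ht : t ∈ U) (hi : (r t).proj ∈ i.1.source) :
    ContDiffAt ℝ ∞ (fun s => legCoord i (r s)) t :=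
  ((contMDiffAt_legCoord i hi).comp t (hr.1.1.contMDiffAt (hU.mem_nhds ht))).contDiffAt

/-- The Hamiltonian map sends a solution of the Hamilton equations to the jet of its
projection. -/
theorem IsHamiltonSolution.jetCoord_hamiltonianMap (hr : IsHamiltonSolution H U r)
    (hU : IsOpen U) (i : atlas (ℝ × Vel m) Q) {t : ℝ} (ht : t ∈ U)
    (hi : (r t).proj ∈ i.1.source) :
    jetCoord i (H.hamiltonianMap (r t)) =
      ((t, (i.1 (r t).proj).2), deriv (fun s => (i.1 (r s).proj).2) t) := by
  rw [H.jetCoord_hamiltonianMap i hi]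
  refine Prod.ext (Prod.ext ?_ rfl) ?_
  · exact (FibredOverTime.chart_time i.1 i.2 _ hi).trans (hr.1.2 t ht)
  · have hd : HasDerivAt (fun s => (i.1 (r s).proj).2) _ t :=
      (((hr.contDiffAt_legCoord hU i ht hi).fst.snd).differentiableAt (by simp)).hasDerivAt
    refine PiLp.ext fun j => ?_
    have h1 := ((basisCovec j : Mom m).hasFDerivAt.comp_hasDerivAt t hd).deriv
    exact ((hr.2 i t ht hi j).1.symm.trans h1)

/-- Common core of both conclusions. Along `Ĥ ∘ r` the momentum `π_j` equals the coordinate `p_j` of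
`r`, whose derivative is `-∂ℋ/∂q^j = ∂ℒ/∂q^j`. The acceleration is kept as the derivative of the
velocity part of `Ĥ ∘ r`, which suits both the second jet of `c` and the Cartan equations. -/
theorem IsHamiltonSolution.lagrange_equation (hr : IsHamiltonSolution H U r) (hU : IsOpen U)
    (hℒ : ContMDiff (JModel m) 𝓘(ℝ, ℝ) ∞ ℒ) (hH : IsWeaklyAssociated H ℒ)
    (hN : ∀ t ∈ U, r t ∈ constraintSpace ℒ) (i : atlas (ℝ × Vel m) Q) {t : ℝ} (ht : t ∈ U)
    (hi : (r t).proj ∈ i.1.source) (j : Fin m) :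
    dPos j (lagrangianIn ℒ i) (jetCoord i (H.hamiltonianMap (r t))) -
      dTotal (deriv (fun s => (i.1 (r s).proj).2) t)
        (deriv (fun s => (jetCoord i (H.hamiltonianMap (r s))).2) t) (momentum ℒ i j)
        (jetCoord i (H.hamiltonianMap (r t))) = 0 := by
  have hev := hr.eventually_mem_source hU i ht hi
  have hρ := hr.contDiffAt_legCoord hU i ht hi
  have hq : HasDerivAt (fun s => (i.1 (r s).proj).2) _ t :=
    ((hρ.fst.snd).differentiableAt (by simp)).hasDerivAt
  have ha : HasDerivAt (fun s => (jetCoord i (H.hamiltonianMap (r s))).2)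
      (deriv (fun s => (jetCoord i (H.hamiltonianMap (r s))).2) t) t := by
    refine DifferentiableAt.hasDerivAt ?_
    have h1 : DifferentiableAt ℝ (fun s => H.velocityIn i (legCoord i (r s))) t :=
      ((H.contDiffAt_velocityIn i (w := legCoord i (r t)) (i.1.map_source hi)).comp
        (f := fun s => legCoord i (r s)) t hρ).differentiableAt (by simp)
    refine h1.congr_of_eventuallyEq ?_
    filter_upwards [hev] with s hs
    rw [H.jetCoord_hamiltonianMap i hs.2]
  -- The tangent of the curve `Ĥ ∘ r` is precisely the direction of the total derivative, with time
  -- component `1`.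
  have hw : HasDerivAt (fun s => jetCoord i (H.hamiltonianMap (r s)))
      ((1, deriv (fun s => (i.1 (r s).proj).2) t),
        deriv (fun s => (jetCoord i (H.hamiltonianMap (r s))).2) t) t := by
    refine (((hasDerivAt_id t).prodMk hq).prodMk ha).congr_of_eventuallyEq ?_
    filter_upwards [hev] with s hs
    rw [hr.jetCoord_hamiltonianMap hU i hs.1 hs.2]
    rfl
  have hmom : DifferentiableAt ℝ (momentum ℒ i j) (jetCoord i (H.hamiltonianMap (r t))) :=
    (((contDiffAt_lagrangianIn hℒ i (w := jetCoord i (H.hamiltonianMap (r t)))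
      (i.1.map_source hi)).fderiv_right (m := ∞) (by simp)).clm_apply
        contDiffAt_const).differentiableAt (by simp)
  have h1 := (hmom.hasFDerivAt.comp_hasDerivAt t hw).deriv
  -- Here `r` living in `N_L` at all times near `t` is essential: `p_j = π_j` must hold on a
  -- neighbourhood to be differentiated.
  have h2 : (fun s => (legCoord i (r s)).2 (basisVec j)) =ᶠ[𝓝 t]
      momentum ℒ i j ∘ fun s => jetCoord i (H.hamiltonianMap (r s)) := by
    filter_upwards [hev] with s hs
    have h := legCoord_legendreMap hℒ i (x := H.hamiltonianMap (r s)) hs.2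
    rw [hH.legendreMap_hamiltonianMap (hN s hs.1)] at h
    rw [h]
    rfl
  rw [← h2.deriv_eq, (hr.2 i t ht hi j).2, hH.fderiv_hamiltonianIn hℒ i (hN t ht) hi, neg_neg] at h1
  rw [dTotal, dPos, ← h1, sub_self]

theorem IsHamiltonSolution.isLagrangeSolution (hr : IsHamiltonSolution H U r) (hU : IsOpen U)
    (hℒ : ContMDiff (JModel m) 𝓘(ℝ, ℝ) ∞ ℒ) (hH : IsWeaklyAssociated H ℒ)
    (hN : ∀ t ∈ U, r t ∈ constraintSpace ℒ) :
    IsLagrangeSolution ℒ U fun t => (r t).proj := by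
  refine ⟨⟨(contMDiff_proj _).comp_contMDiffOn hr.1.1, hr.1.2⟩, fun i t ht hi j => ?_⟩
  have h := hr.lagrange_equation hU hℒ hH hN i ht hi j
  -- The velocity part of `Ĥ ∘ r` is `dq/dt` on a neighbourhood of `t`, so its derivative at `t` is
  -- the second derivative of `q`.
  have h2 : (fun s => (jetCoord i (H.hamiltonianMap (r s))).2) =ᶠ[𝓝 t]
      deriv fun s => (i.1 (r s).proj).2 := by
    filter_upwards [hr.eventually_mem_source hU i ht hi] with s hs
    rw [hr.jetCoord_hamiltonianMap hU i hs.1 hs.2]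
  rwa [h2.deriv_eq, hr.jetCoord_hamiltonianMap hU i ht hi] at h

theorem IsHamiltonSolution.isCartanSolution (hr : IsHamiltonSolution H U r) (hU : IsOpen U)
    (hℒ : ContMDiff (JModel m) 𝓘(ℝ, ℝ) ∞ ℒ) (hH : IsWeaklyAssociated H ℒ)
    (hN : ∀ t ∈ U, r t ∈ constraintSpace ℒ) :
    IsCartanSolution ℒ U fun t => H.hamiltonianMap (r t) := by
  refine ⟨⟨H.contMDiff_hamiltonianMap.comp_contMDiffOn hr.1.1, hr.1.2⟩, fun i t ht hi j => ?_⟩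
  -- The velocity of `Ĥ ∘ r` is the derivative of its own base curve, so every factor `q̂_t - q_t`
  -- vanishes and only the Lagrange expression remains.
  have hv : (jetCoord i (H.hamiltonianMap (r t))).2 =
      deriv (fun s => (jetCoord i (H.hamiltonianMap (r s))).1.2) t :=
    congrArg Prod.snd (hr.jetCoord_hamiltonianMap hU i ht hi)
  have h := hr.lagrange_equation hU hℒ hH hN i ht hi j
  simp only [hv, sub_self, mul_zero, zero_mul, Finset.sum_const_zero, add_zero, true_and]
  exact h

end Solutions

end TimeMech

end

theorem mainTheorem5 (m : ℕ)
    (M : Type*) [TopologicalSpace M] [ChartedSpace (EuclideanSpace ℝ (Fin m)) M]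
    [IsManifold 𝓘(ℝ, EuclideanSpace ℝ (Fin m)) ∞ M]
    (Q : Type*) [TopologicalSpace Q] [ChartedSpace (ℝ × TimeMech.Vel m) Q]
    [IsManifold (TimeMech.QModel m) ∞ Q] [TimeMech.FibredOverTime m Q]
    (hQ : TimeMech.IsSmoothFibreBundle ℝ (ℝ × TimeMech.Vel m) (EuclideanSpace ℝ (Fin m)) M
      (TimeMech.time m : Q → ℝ))
    (ℒ : TimeMech.JetBundle m Q → ℝ)
    (hℒ : ContMDiff (TimeMech.JModel m) 𝓘(ℝ, ℝ) ∞ ℒ)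
    (hreg : TimeMech.IsAlmostRegular ℒ)
    (H : TimeMech.HamiltonianForm m Q)
    (hH : TimeMech.IsWeaklyAssociated H ℒ)
    (U : Set ℝ) (hU : IsOpen U)
    (r : ℝ → TimeMech.LegendreBundle m Q)
    (hr : TimeMech.IsHamiltonSolution H U r)
    (hN : ∀ t ∈ U, r t ∈ TimeMech.constraintSpace ℒ) :
    TimeMech.IsLagrangeSolution ℒ U (fun t => (r t).proj) ∧
      TimeMech.IsCartanSolution ℒ U (fun t => H.hamiltonianMap (r t)) :=
  ⟨hr.isLagrangeSolution hU hℒ hH hN, hr.isCartanSolution hU hℒ hH hN⟩
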